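/- Let $(X,x_0)$ be a pointed topological space and $n\ge 2$. For a path $\sigma$ in $X$ from $x_0$ to $x_1$ let $\sigma_\#:\pi_n(X,x_1)\to\pi_n(X,x_0)$ be the change-of-base-point isomorphism: $\sigma_\#[\alpha]=[F(\cdot,1)]$ for any homotopy $F:I^n\times I\to X$ with $F(s,0)=\alpha(s)$ for $s\in I^n$ and $F(s,t)=\sigma(1-t)$ for $s\in\partial I^n$. A *neighbourhood family* on a group $G$ is a nonempty set $\Sigma$ of subgroups such that for all $H,K\in\Sigma$ some $S\in\Sigma$ satisfies $S\subseteq H\cap K$; the *subgroup topology* determined by $\Sigma$ is the topology on $G$ generated by all left cosets of members of $\Sigma$. Write $A\preccurlyeq B$ if the topology of $B$ is finer than (or equal to) that of $A$. For an open cover $\mathcal U$ of $X$ let * $\pi^{sp}(\mathcal U,x_0)$ be the subgroup of $\pi_n(X,x_0)$ generated by all $\sigma_\#[v]$, where $\sigma$ is a path starting at $x_0$ and $v$ is an $n$-loop at $\sigma(1)$ with image in one member of $\mathcal U$; * $\pi^{tsp}(\mathcal U,x_0)$ be the subgroup generated by all $\sigma_\#[f_1\circledast f_2]$, where $\sigma$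 is a path starting at $x_0$, $f_1,f_2:(D^n,s_0)\to(X,\sigma(1))$ are pointed maps with $s_0\in\partial D^n$ that agree on $\partial D^n$, each having its image in some member of $\mathcal U$, and $f_1\circledast f_2:S^n\to X$ equals $f_1$ on the upper and $f_2$ on the lower hemisphere (identified with $D^n$ by vertical projection), $(S^n,s_0)$ being identified with $I^n/\partial I^n$; * $\pi^{wtsp}(\mathcal U,x_0)$ be the subgroup generated by all $\sigma_\#[v]$, where $\sigma$ is a path starting at $x_0$ and $v$ is an $n$-loop at $\sigma(1)$ with image in $U_1\cup U_2$ for some $U_1,U_2\in\mathcal U$. As $\mathcal U$ runs over all open covers of $X$, each of these three kinds of subgroups forms a neighbourhood family; the subgroup topologies they determine are denoted $\pi_n^{Span}(X,x_0)$, $\pi_n^{tSpan}(X,x_0)$, $\pi_n^{wtSpan}(X,x_0)$. A *path open cover* of $(X,x_0)$ is a family $\mathcal V=\{V_\alpha\}$ of open subsets of $X$ indexed by all paths $\alpha$ in $X$ starting at $x_0$, with $\alpha(1)\in V_\alpha$ (so $\mathcal V$ covers the path component of $x_0$, and it is an open cover of $X$ if $X$ is path connected). Let $\widetilde\pi^{sp}(\mathcal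 V,x_0)$ be the subgroup generated by all $\alpha_\#[v]$, where $\alpha$ is a path starting at $x_0$ and $v$ is an $n$-loop at $\alpha(1)$ with image in $V_\alpha$. These subgroups form a neighbourhood family; the subgroup topology it determines is $\pi_n^{pSpan}(X,x_0)$. Let $\mathrm{cov}(X)$ be the set of pairs $(\mathcal U,U_0)$, where $\mathcal U$ is a locally finite open cover of $X$ and $U_0\in\mathcal U$ contains $x_0$, such that there is a partition of unity $(\varphi_U)_{U\in\mathcal U}$ subordinate to $\mathcal U$ with $\varphi_{U_0}(x_0)=1$ (this is automatic if $X$ is paracompact Hausdorff). Let $|N(\mathcal U)|$ be the geometric realization, with the weak topology, of the nerve of $\mathcal U$, and let $p_{\mathcal U}:(X,x_0)\to(|N(\mathcal U)|,U_0)$ be the canonical map with barycentric coordinates $\varphi_U(x)$, which is unique up to pointed homotopy. If $(\mathcal V,V_0)$ refines $(\mathcal U,U_0)$, let $p_{\mathcal U\mathcal V}:|N(\mathcal V)|\to|N(\mathcal U)|$ be a simplicial map sending each vertex $V$ to some $U\supseteq V$, and $V_0$ to $U_0$. The $n$-th shape homotopy group $\check\pi_n(X,x_0)$ is the inverse limit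 of the discrete groups $\pi_n(|N(\mathcal U)|,U_0)$ along the maps $p_{\mathcal U\mathcal V\#}$, with the inverse limit topology, and $\pi_n^{sh}(X,x_0)$ is $\pi_n(X,x_0)$ with the initial topology with respect to $\Psi_n:\pi_n(X,x_0)\to\check\pi_n(X,x_0)$, $[\alpha]\mapsto([p_{\mathcal U}\circ\alpha])_{\mathcal U}$. Then $$\pi_n^{sh}(X,x_0)\preccurlyeq\pi_n^{wtSpan}(X,x_0)\preccurlyeq\pi_n^{tSpan}(X,x_0)\preccurlyeq\pi_n^{Span}(X,x_0)\preccurlyeq\pi_n^{pSpan}(X,x_0).$$ -/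

import Mathlib

open scoped Topology Topology.Homotopy Pointwise

noncomputable section

namespace TopHomotopy

/-! ### Subgroup topologies -/

/-- A neighbourhood family on a group: a nonempty family of subgroups in which the intersection of
any two members contains a third member. -/
structure NbhdFamily (G : Type*) [Group G] where
  /-- the subgroups of the family -/
  carrier : Set (Subgroup G)
  nonempty : carrier.Nonempty
  directed : ∀ H ∈ carrier, ∀ K ∈ carrier, ∃ S ∈ carrier, S ≤ H ⊓ K

/-- The subgroup topology determined by a neighbourhood family: the topology generated by all left
cosets of members of the family. -/
abbrev NbhdFamily.topology {G : Type*} [Group G] (F : NbhdFamily G) : TopologicalSpace G :=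
  TopologicalSpace.generateFrom {S | ∃ H ∈ F.carrier, ∃ g : G, S = g • (H : Set G)}

/-- `IsCoarser A B` is the relation `A ≼ B`: every `A`-open set is `B`-open. -/
def IsCoarser {G : Type*} (A B : TopologicalSpace G) : Prop :=
  ∀ s : Set G, IsOpen[A] s → IsOpen[B] s

infix:50 " ≼ₜ " => IsCoarser

/-! ### The change of base point along a path -/

section Transport

variable {X : Type*} [TopologicalSpace X]

/-- `IsTransport σ α β`, for a path `σ` from `x₀` to `x₁`, an `n`-loop `α` at `x₁` and an `n`-loop
`β` at `x₀`: there is a homotopy `F` with `F(s,0) = α(s)`, `F(s,1) = β(s)` and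
`F(s,t) = σ⁻¹(t)` for `s ∈ ∂Iⁿ`; that is, `[β] = σ_#[α]`. -/
def IsTransport {n : ℕ} {x₀ x₁ : X} (σ : Path x₀ x₁)
    (α : GenLoop (Fin n) X x₁) (β : GenLoop (Fin n) X x₀) : Prop :=
  ∃ F : C((Fin n → unitInterval) × unitInterval, X),
    (∀ s, F (s, 0) = α s) ∧ (∀ s, F (s, 1) = β s) ∧
      ∀ s ∈ Cube.boundary (Fin n), ∀ t, F (s, t) = σ.symm t

/-- The subgroup of `π_n(X,x₀)` generated by all `σ_#[v]`, where `σ` is a path from `x₀` to some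
point `y` and `v` is an `n`-loop at `y` such that `P σ v`. -/
def transportSubgroup (n : ℕ) [NeZero n] (x₀ : X)
    (P : ∀ {y : X}, Path x₀ y → GenLoop (Fin n) X y → Prop) : Subgroup (π_ n X x₀) :=
  Subgroup.closure {c | ∃ (y : X) (σ : Path x₀ y) (v : GenLoop (Fin n) X y)
    (β : GenLoop (Fin n) X x₀), P σ v ∧ IsTransport σ v β ∧ c = Quotient.mk _ β}

theorem transportSubgroup_mono {n : ℕ} [NeZero n] {x₀ : X}
    {P Q : ∀ {y : X}, Path x₀ y → GenLoop (Fin n) X y → Prop}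
    (h : ∀ {y : X} (σ : Path x₀ y) (v : GenLoop (Fin n) X y), P σ v → Q σ v) :
    transportSubgroup n x₀ P ≤ transportSubgroup n x₀ Q := by
  apply Subgroup.closure_mono
  rintro c ⟨y, σ, v, β, hP, hT⟩
  exact ⟨y, σ, v, β, h σ v hP, hT⟩

end Transport

/-! ### Open covers -/

/-- An open cover of `X`. -/
structure IsOpenCover {X : Type*} [TopologicalSpace X] (𝒰 : Set (Set X)) : Prop where
  isOpen : ∀ U ∈ 𝒰, IsOpen U
  covers : ⋃₀ 𝒰 = Set.univ

/-- A path open cover of the pointed space `(X, x₀)`: a family of open sets `V α`, indexed by the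
paths `α` starting at `x₀`, with `α(1) ∈ V α`. -/
structure PathOpenCover (X : Type*) [TopologicalSpace X] (x₀ : X) where
  /-- the open set assigned to a path -/
  V : ∀ {y : X}, Path x₀ y → Set X
  isOpen : ∀ {y : X} (α : Path x₀ y), IsOpen (V α)
  mem : ∀ {y : X} (α : Path x₀ y), y ∈ V α

/-- The sets of a path open cover cover the path component of the base point. -/
theorem PathOpenCover.pathComponent_subset {X : Type*} [TopologicalSpace X] {x₀ : X}
    (𝒱 : PathOpenCover X x₀) :
    pathComponent x₀ ⊆ ⋃ (y : X) (α : Path x₀ y), 𝒱.V α := by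
  intro y hy
  obtain ⟨α⟩ := hy
  exact Set.mem_iUnion₂.2 ⟨y, α, 𝒱.mem α⟩

/-- Hence they form an open cover of `X` if `X` is path connected. -/
theorem PathOpenCover.isOpenCover {X : Type*} [TopologicalSpace X] [PathConnectedSpace X] {x₀ : X}
    (𝒱 : PathOpenCover X x₀) :
    IsOpenCover {U : Set X | ∃ (y : X) (α : Path x₀ y), U = 𝒱.V α} where
  isOpen := by rintro _ ⟨y, α, rfl⟩; exact 𝒱.isOpen α
  covers := by
    refine Set.eq_univ_of_forall fun y => ?_
    let α := PathConnectedSpace.somePath x₀ y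
    exact ⟨𝒱.V α, ⟨y, α, rfl⟩, 𝒱.mem α⟩

section Covers

variable {X : Type*} [TopologicalSpace X]

theorem isOpenCover_singleton_univ : IsOpenCover ({Set.univ} : Set (Set X)) where
  isOpen := by rintro U rfl; exact isOpen_univ
  covers := by simp

theorem IsOpenCover.inter {𝒰 𝒲 : Set (Set X)} (h𝒰 : IsOpenCover 𝒰) (h𝒲 : IsOpenCover 𝒲) :
    IsOpenCover {S | ∃ U ∈ 𝒰, ∃ W ∈ 𝒲, S = U ∩ W} where
  isOpen := by
    rintro _ ⟨U, hU, W, hW, rfl⟩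
    exact (h𝒰.isOpen U hU).inter (h𝒲.isOpen W hW)
  covers := by
    refine Set.eq_univ_of_forall fun x => ?_
    have h1 : x ∈ ⋃₀ 𝒰 := h𝒰.covers ▸ Set.mem_univ x
    have h2 : x ∈ ⋃₀ 𝒲 := h𝒲.covers ▸ Set.mem_univ x
    obtain ⟨U, hU, hxU⟩ := h1
    obtain ⟨W, hW, hxW⟩ := h2
    exact ⟨U ∩ W, ⟨U, hU, W, hW, rfl⟩, hxU, hxW⟩

/-- A family of subgroups, indexed by the open covers of `X` and monotone under refinement, is a
neighbourhood family. -/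
def nbhdFamilyOfCovers {G : Type*} [Group G] (S : Set (Set X) → Subgroup G)
    (hS : ∀ 𝒰 𝒲 : Set (Set X), (∀ W ∈ 𝒲, ∃ U ∈ 𝒰, W ⊆ U) → S 𝒲 ≤ S 𝒰) : NbhdFamily G where
  carrier := {H | ∃ 𝒰 : Set (Set X), IsOpenCover 𝒰 ∧ H = S 𝒰}
  nonempty := ⟨_, _, isOpenCover_singleton_univ, rfl⟩
  directed := by
    rintro _ ⟨𝒰, h𝒰, rfl⟩ _ ⟨𝒲, h𝒲, rfl⟩
    refine ⟨_, ⟨_, h𝒰.inter h𝒲, rfl⟩, le_inf (hS _ _ ?_) (hS _ _ ?_)⟩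
    · rintro _ ⟨U, hU, W, -, rfl⟩
      exact ⟨U, hU, Set.inter_subset_left⟩
    · rintro _ ⟨U, -, W, hW, rfl⟩
      exact ⟨W, hW, Set.inter_subset_right⟩

end Covers

/-! ### Spheres, discs and the map `f₁ ⊛ f₂` -/

/-- The closed unit disc `Dⁿ`. -/
abbrev Disc (n : ℕ) : Type := Metric.closedBall (0 : EuclideanSpace ℝ (Fin n)) 1

/-- The unit sphere `Sⁿ` in `ℝⁿ⁺¹`. -/
abbrev Sph (n : ℕ) : Type := Metric.sphere (0 : EuclideanSpace ℝ (Fin (n + 1))) 1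

/-- The height of a point of the sphere. The hemisphere `Sⁿ₊` consists of the points of height
`≥ 0`, the hemisphere `Sⁿ₋` of those of height `≤ 0`. -/
def Sph.height {n : ℕ} (z : Sph n) : ℝ := z.1 (Fin.last n)

/-- The vertical projection of the sphere to the disc; it identifies each of the hemispheres `Sⁿ₊`
and `Sⁿ₋` with `Dⁿ`, and the equator with `∂Dⁿ`. -/
def Sph.toDisc {n : ℕ} (z : Sph n) : Disc n :=
  ⟨WithLp.toLp 2 fun i => z.1 i.castSucc, by
    have hz : ‖z.1‖ = 1 := by simp
    have h1 : ‖z.1‖ ^ 2 = 1 := by rw [hz]; norm_num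
    rw [EuclideanSpace.norm_sq_eq, Fin.sum_univ_castSucc] at h1
    rw [mem_closedBall_zero_iff, ← sq_le_one_iff₀ (norm_nonneg _), EuclideanSpace.norm_sq_eq]
    simp only [Real.norm_eq_abs, sq_abs] at h1 ⊢
    nlinarith [sq_nonneg (z.1 (Fin.last n))]⟩

open Classical in
/-- The map `f₁ ⊛ f₂ : Sⁿ → X`, equal to `f₁` on `Sⁿ₊` and to `f₂` on `Sⁿ₋`; it is meant for maps
`f₁`, `f₂` that agree on `∂Dⁿ`. -/
def discUnion {X : Type*} {n : ℕ} (f₁ f₂ : Disc n → X) (z : Sph n) : X :=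
  if 0 ≤ z.height then f₁ z.toDisc else f₂ z.toDisc

/-- An identification of the quotient `Iⁿ / ∂Iⁿ` with the pointed sphere `(Sⁿ, s₀)`: a continuous
map `Iⁿ → Sⁿ` that sends `∂Iⁿ` to `s₀` and is a bijection of the complements. -/
structure IsCollapse {n : ℕ} (q : C(Fin n → unitInterval, Sph n)) (s₀ : Sph n) : Prop where
  boundary : ∀ t ∈ Cube.boundary (Fin n), q t = s₀
  bijOn : Set.BijOn q (Cube.boundary (Fin n))ᶜ {s₀}ᶜ

/-! ### Spanier subgroups and Spanier topologies -/

section Spanier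

variable {X : Type*} [TopologicalSpace X]

/-- The `n`-Spanier subgroup of an open cover, generated by the `σ_#[v]` with `v` lying in one
member of the cover. -/
def spanier (n : ℕ) [NeZero n] (x₀ : X) (𝒰 : Set (Set X)) : Subgroup (π_ n X x₀) :=
  transportSubgroup n x₀ fun _ v => ∃ U ∈ 𝒰, Set.range v ⊆ U

/-- The `n`-loop `v` is `f₁ ⊛ f₂` for pointed discs `f₁, f₂ : (Dⁿ, s₀) → (X, y)` that agree on
`∂Dⁿ` and have images in members `U₁`, `U₂` of `𝒰`, where `Iⁿ / ∂Iⁿ` is identified with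
`(Sⁿ, s₀)`, the base point `s₀` being on the equator. -/
def IsThick {n : ℕ} {y : X} (𝒰 : Set (Set X)) (v : GenLoop (Fin n) X y) : Prop :=
  ∃ (q : C(Fin n → unitInterval, Sph n)) (s₀ : Sph n) (f₁ f₂ : C(Disc n, X)),
    s₀.height = 0 ∧ IsCollapse q s₀ ∧
    f₁ s₀.toDisc = y ∧ f₂ s₀.toDisc = y ∧
    (∀ x : Disc n, ‖x.1‖ = 1 → f₁ x = f₂ x) ∧
    (∃ U₁ ∈ 𝒰, Set.range f₁ ⊆ U₁) ∧ (∃ U₂ ∈ 𝒰, Set.range f₂ ⊆ U₂) ∧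
    ∀ t, v t = discUnion f₁ f₂ (q t)

/-- The `n`-thick Spanier subgroup of an open cover, generated by the `σ_#[f₁ ⊛ f₂]`. -/
def thickSpanier (n : ℕ) [NeZero n] (x₀ : X) (𝒰 : Set (Set X)) : Subgroup (π_ n X x₀) :=
  transportSubgroup n x₀ fun _ v => IsThick 𝒰 v

/-- The `n`-weak thick Spanier subgroup of an open cover, generated by the `σ_#[v]` with `v` lying
in the union of two members of the cover. -/
def weakThickSpanier (n : ℕ) [NeZero n] (x₀ : X) (𝒰 : Set (Set X)) : Subgroup (π_ n X x₀) :=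
  transportSubgroup n x₀ fun _ v => ∃ U₁ ∈ 𝒰, ∃ U₂ ∈ 𝒰, Set.range v ⊆ U₁ ∪ U₂

/-- The `n`-path Spanier subgroup of a path open cover, generated by the `α_#[v]` with `v` lying
in `V α`. -/
def pathSpanier (n : ℕ) [NeZero n] {x₀ : X} (𝒱 : PathOpenCover X x₀) : Subgroup (π_ n X x₀) :=
  transportSubgroup n x₀ fun α v => Set.range v ⊆ 𝒱.V α

theorem spanier_mono (n : ℕ) [NeZero n] (x₀ : X) (𝒰 𝒲 : Set (Set X))
    (h : ∀ W ∈ 𝒲, ∃ U ∈ 𝒰, W ⊆ U) : spanier n x₀ 𝒲 ≤ spanier n x₀ 𝒰 := by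
  apply transportSubgroup_mono
  rintro y σ v ⟨W, hW, hv⟩
  obtain ⟨U, hU, hWU⟩ := h W hW
  exact ⟨U, hU, hv.trans hWU⟩

theorem thickSpanier_mono (n : ℕ) [NeZero n] (x₀ : X) (𝒰 𝒲 : Set (Set X))
    (h : ∀ W ∈ 𝒲, ∃ U ∈ 𝒰, W ⊆ U) : thickSpanier n x₀ 𝒲 ≤ thickSpanier n x₀ 𝒰 := by
  apply transportSubgroup_mono
  rintro y σ v ⟨q, s₀, f₁, f₂, h0, hq, h1, h2, h3, ⟨W₁, hW₁, hf₁⟩, ⟨W₂, hW₂, hf₂⟩, hv⟩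
  obtain ⟨U₁, hU₁, hWU₁⟩ := h W₁ hW₁
  obtain ⟨U₂, hU₂, hWU₂⟩ := h W₂ hW₂
  exact ⟨q, s₀, f₁, f₂, h0, hq, h1, h2, h3, ⟨U₁, hU₁, hf₁.trans hWU₁⟩,
    ⟨U₂, hU₂, hf₂.trans hWU₂⟩, hv⟩

theorem weakThickSpanier_mono (n : ℕ) [NeZero n] (x₀ : X) (𝒰 𝒲 : Set (Set X))
    (h : ∀ W ∈ 𝒲, ∃ U ∈ 𝒰, W ⊆ U) : weakThickSpanier n x₀ 𝒲 ≤ weakThickSpanier n x₀ 𝒰 := by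
  apply transportSubgroup_mono
  rintro y σ v ⟨W₁, hW₁, W₂, hW₂, hv⟩
  obtain ⟨U₁, hU₁, hWU₁⟩ := h W₁ hW₁
  obtain ⟨U₂, hU₂, hWU₂⟩ := h W₂ hW₂
  exact ⟨U₁, hU₁, U₂, hU₂, hv.trans (Set.union_subset_union hWU₁ hWU₂)⟩

/-- The Spanier topology on `π_n(X,x₀)`. -/
abbrev spanierTopology (n : ℕ) [NeZero n] (x₀ : X) : TopologicalSpace (π_ n X x₀) :=
  (nbhdFamilyOfCovers (spanier n x₀) (spanier_mono n x₀)).topology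

/-- The thick Spanier topology on `π_n(X,x₀)`. -/
abbrev thickSpanierTopology (n : ℕ) [NeZero n] (x₀ : X) : TopologicalSpace (π_ n X x₀) :=
  (nbhdFamilyOfCovers (thickSpanier n x₀) (thickSpanier_mono n x₀)).topology

/-- The weak thick Spanier topology on `π_n(X,x₀)`. -/
abbrev weakThickSpanierTopology (n : ℕ) [NeZero n] (x₀ : X) : TopologicalSpace (π_ n X x₀) :=
  (nbhdFamilyOfCovers (weakThickSpanier n x₀) (weakThickSpanier_mono n x₀)).topology

/-- The neighbourhood family of all `n`-path Spanier subgroups of path open covers. -/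
def pathSpanierFamily (n : ℕ) [NeZero n] (x₀ : X) : NbhdFamily (π_ n X x₀) where
  carrier := {H | ∃ 𝒱 : PathOpenCover X x₀, H = pathSpanier n 𝒱}
  nonempty := ⟨_, ⟨fun _ => Set.univ, fun _ => isOpen_univ, fun _ => Set.mem_univ _⟩, rfl⟩
  directed := by
    rintro _ ⟨𝒱, rfl⟩ _ ⟨𝒲, rfl⟩
    refine ⟨_, ⟨⟨fun α => 𝒱.V α ∩ 𝒲.V α, fun α => (𝒱.isOpen α).inter (𝒲.isOpen α),
      fun α => ⟨𝒱.mem α, 𝒲.mem α⟩⟩, rfl⟩, le_inf ?_ ?_⟩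
    · exact transportSubgroup_mono fun σ v hv => hv.trans Set.inter_subset_left
    · exact transportSubgroup_mono fun σ v hv => hv.trans Set.inter_subset_right

/-- The path Spanier topology on `π_n(X,x₀)`. -/
abbrev pathSpanierTopology (n : ℕ) [NeZero n] (x₀ : X) : TopologicalSpace (π_ n X x₀) :=
  (pathSpanierFamily n x₀).topology

end Spanier

/-! ### The homomorphism of homotopy groups induced by a pointed map -/

section Induced

variable {X Y : Type*} [TopologicalSpace X] [TopologicalSpace Y]

/-- The composition of an `n`-loop with a pointed map. -/
def mapLoop {n : ℕ} {x₀ : X} {y₀ : Y} (f : C(X, Y)) (hf : f x₀ = y₀) (α : GenLoop (Fin n) X x₀) :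
    GenLoop (Fin n) Y y₀ :=
  ⟨f.comp α.1, fun t ht => by
    exact (congrArg f (α.2 t ht)).trans hf⟩

theorem mapLoop_homotopic {n : ℕ} {x₀ : X} {y₀ : Y} (f : C(X, Y)) (hf : f x₀ = y₀)
    {α β : GenLoop (Fin n) X x₀} (h : GenLoop.Homotopic α β) :
    GenLoop.Homotopic (mapLoop f hf α) (mapLoop f hf β) :=
  ContinuousMap.HomotopicRel.comp_continuousMap h f

/-- The homomorphism `f_# : π_n(X,x₀) → π_n(Y,y₀)`, `[α] ↦ [f ∘ α]`. -/
def inducedHom (n : ℕ) [NeZero n] {x₀ : X} {y₀ : Y} (f : C(X, Y)) (hf : f x₀ = y₀) :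
    π_ n X x₀ →* π_ n Y y₀ :=
  MonoidHom.mk'
    (Quotient.map (mapLoop f hf) fun _ _ h => mapLoop_homotopic f hf h)
    (by
      rintro ⟨a⟩ ⟨b⟩
      have h1 := HomotopyGroup.mul_spec (i := (0 : Fin n)) (p := a) (q := b)
      have h2 := HomotopyGroup.mul_spec (i := (0 : Fin n)) (p := mapLoop f hf a)
        (q := mapLoop f hf b)
      refine (congrArg (Quotient.map (mapLoop f hf) fun _ _ h => mapLoop_homotopic f hf h) h1).trans
        (Eq.trans ?_ h2.symm)
      refine congrArg (Quotient.mk _) ?_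
      ext t
      change f (if _ then _ else _) = if _ then _ else _
      split_ifs <;> rfl)

end Induced

/-! ### Geometric realization of abstract simplicial complexes -/

section Realization

variable {V W : Type*}

/-- The geometric realization `|K|`: its points are the families of barycentric coordinates whose
support is a face of `K`. -/
def Realization (K : PreAbstractSimplicialComplex V) : Type _ :=
  {x : V →₀ ℝ // (∀ v, 0 ≤ x v) ∧ x.support ∈ K.faces ∧ (x.sum fun _ r => r) = 1}

/-- The closed simplex spanned by a finite set `s` of vertices. -/
def Realization.Simplex (K : PreAbstractSimplicialComplex V) (s : Finset V) : Type _ :=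
  {x : Realization K // x.1.support ⊆ s}

/-- The Euclidean topology on a closed simplex, given by the barycentric coordinates. -/
instance Realization.Simplex.instTopologicalSpace (K : PreAbstractSimplicialComplex V)
    (s : Finset V) : TopologicalSpace (Realization.Simplex K s) :=
  TopologicalSpace.induced (fun (x : Realization.Simplex K s) (v : V) => x.1.1 v)
    Pi.topologicalSpace

/-- The weak topology on `|K|`: a set is open iff its trace on every closed simplex of `K` is open
in the Euclidean topology of that simplex. -/
instance Realization.instTopologicalSpace (K : PreAbstractSimplicialComplex V) :
    TopologicalSpace (Realization K) :=
  ⨆ s : K.faces, TopologicalSpace.coinduced (fun x : Realization.Simplex K s.1 => x.1)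
    inferInstance

/-- A vertex, as a point of the realization. -/
def Realization.vertex (K : PreAbstractSimplicialComplex V) (v : V) (hv : {v} ∈ K.faces) :
    Realization K :=
  ⟨Finsupp.single v 1, by
    classical
    intro w
    rw [Finsupp.single_apply]
    split_ifs <;> norm_num, by
    rwa [Finsupp.support_single _ one_ne_zero], by simp⟩

/-- For the coordinates of a point of `|K|` it suffices that the support is contained in a face. -/
theorem Realization.support_mem {K : PreAbstractSimplicialComplex V} {x : V →₀ ℝ} {s : Finset V}
    (hs : s ∈ K.faces) (hx : x.support ⊆ s) (h1 : (x.sum fun _ r => r) = 1) :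
    x.support ∈ K.faces := by
  refine (K.isRelLowerSet_faces hs).2 hx ?_
  rw [Finset.nonempty_iff_ne_empty]
  intro h
  rw [Finsupp.support_eq_empty] at h
  subst h
  simp at h1

theorem Realization.continuous_coord (K : PreAbstractSimplicialComplex V) (v : V) :
    Continuous fun x : Realization K => x.1 v := by
  refine continuous_iSup_dom.2 fun s => continuous_coinduced_dom.2 ?_
  exact (continuous_apply v).comp continuous_induced_dom

theorem Realization.continuous_simplex (K : PreAbstractSimplicialComplex V) {s : Finset V}
    (hs : s ∈ K.faces) : Continuous fun x : Realization.Simplex K s => x.1 :=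
  continuous_iSup_rng (i := (⟨s, hs⟩ : K.faces)) continuous_coinduced_rng

/-- A map into a realization is continuous if its barycentric coordinates are continuous and have
locally finite supports. -/
theorem Realization.continuous_of_coord {Y : Type*} [TopologicalSpace Y]
    {K : PreAbstractSimplicialComplex V} (h : Y → Realization K)
    (hc : ∀ v, Continuous fun y => (h y).1 v)
    (hl : LocallyFinite fun v => {y | (h y).1 v ≠ 0}) : Continuous h := by
  classical
  rw [continuous_iff_continuousAt]
  intro y
  obtain ⟨N, hN, hfin⟩ := hl y
  let S : Finset V := hfin.toFinset
  have hS : ∀ z ∈ N, (h z).1.support ⊆ S := by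
    intro z hz v hv
    rw [Finsupp.mem_support_iff] at hv
    exact hfin.mem_toFinset.2 ⟨z, hv, hz⟩
  let T : {t : Finset.powerset S // t.1 ∈ K.faces} → Set Y :=
    fun t => {z | (h z).1.support ⊆ t.1.1}
  have hT : ∀ t, IsClosed (T t) := fun t => by
    have : T t = ⋂ v, ⋂ (_ : v ∉ t.1.1), {z | (h z).1 v = 0} := by
      ext z
      simp only [T, Set.mem_iInter]
      constructor
      · intro hz v hv
        by_contra hne
        exact hv (hz (Finsupp.mem_support_iff.2 hne))
      · intro hz v hv
        by_contra hvt
        exact (Finsupp.mem_support_iff.1 hv) (hz v hvt)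
    rw [this]
    exact isClosed_iInter fun v => isClosed_iInter fun _ => isClosed_eq (hc v) continuous_const
  have hTc : ∀ t, ContinuousOn h (T t) := by
    intro t
    rw [continuousOn_iff_continuous_domRestrict]
    let g : T t → Realization.Simplex K t.1.1 := fun z => ⟨h z.1, z.2⟩
    have hg : Continuous g :=
      continuous_induced_rng.2 (continuous_pi fun v => (hc v).comp continuous_subtype_val)
    exact (Realization.continuous_simplex K t.2).comp hg
  have hU := (locallyFinite_of_finite T).continuousOn_iUnion hT hTc
  refine hU.continuousAt (Filter.mem_of_superset hN fun z hz => ?_)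
  exact Set.mem_iUnion.2 ⟨⟨⟨(h z).1.support, Finset.mem_powerset.2 (hS z hz)⟩, (h z).2.2.1⟩,
    Finset.Subset.refl _⟩

open Classical in
/-- The linear extension of a vertex map `r`, as a map of sets. -/
def Realization.mapFun {K : PreAbstractSimplicialComplex V} {L : PreAbstractSimplicialComplex W}
    (r : V → W) (hr : ∀ s ∈ K.faces, s.image r ∈ L.faces) (x : Realization K) : Realization L :=
  ⟨Finsupp.mapDomain r x.1, by
    have h1 : ((Finsupp.mapDomain r x.1).sum fun _ c => c) = 1 := by
      rw [Finsupp.sum_mapDomain_index (fun _ => rfl) (fun _ _ _ => rfl)]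
      exact x.2.2.2
    refine ⟨fun w => ?_, ?_, h1⟩
    · rw [Finsupp.mapDomain, Finsupp.sum, Finsupp.finsetSum_apply]
      refine Finset.sum_nonneg fun v _ => ?_
      rw [Finsupp.single_apply]
      split_ifs
      · exact x.2.1 v
      · exact le_rfl
    · exact Realization.support_mem (hr _ x.2.2.1) Finsupp.mapDomain_support h1⟩

open Classical in
/-- The simplicial map `|K| → |L|` that extends a vertex map `r` linearly. -/
def Realization.map {K : PreAbstractSimplicialComplex V} {L : PreAbstractSimplicialComplex W}
    (r : V → W) (hr : ∀ s ∈ K.faces, s.image r ∈ L.faces) : C(Realization K, Realization L) where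
  toFun := Realization.mapFun r hr
  continuous_toFun := by
    refine continuous_iSup_dom.2 fun s => continuous_coinduced_dom.2 ?_
    let g : Realization.Simplex K s.1 → Realization.Simplex L (s.1.image r) := fun x =>
      ⟨Realization.mapFun r hr x.1,
        Finsupp.mapDomain_support.trans (Finset.image_subset_image x.2)⟩
    have hg : Continuous g := by
      refine continuous_induced_rng.2 (continuous_pi fun w => ?_)
      have : (fun x : Realization.Simplex K s.1 => (g x).1.1 w) =
          fun x => ∑ v ∈ s.1, if r v = w then x.1.1 v else 0 := by
        funext x
        change Finsupp.mapDomain r x.1.1 w = _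
        rw [Finsupp.mapDomain, Finsupp.sum_of_support_subset _ x.2 _ (by simp),
          Finsupp.finsetSum_apply]
        simp only [Finsupp.single_apply]
      change Continuous fun x : Realization.Simplex K s.1 => (g x).1.1 w
      rw [this]
      refine continuous_finsetSum _ fun v _ => ?_
      split_ifs
      · exact (continuous_apply v).comp continuous_induced_dom
      · exact continuous_const
    exact (Realization.continuous_simplex L (hr _ s.2)).comp hg

/-- Two maps into `|K|` with locally finite supports that send every point into a common simplex
are homotopic by a straight-line homotopy, which is constant where they agree. Hence they induce
the same homomorphism. -/
theorem inducedHom_eq_of_contiguous {Y : Type*} [TopologicalSpace Y] (n : ℕ) [NeZero n]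
    {K : PreAbstractSimplicialComplex V} {y₀ : Y} {p : Realization K} (f g : C(Y, Realization K))
    (hf : f y₀ = p) (hg : g y₀ = p)
    (hlf : LocallyFinite fun v => {y | (f y).1 v ≠ 0 ∨ (g y).1 v ≠ 0})
    (hfg : ∀ y, ∃ s ∈ K.faces, (f y).1.support ⊆ s ∧ (g y).1.support ⊆ s) :
    inducedHom n f hf = inducedHom n g hg := by
  classical
  let c : unitInterval × Y → V →₀ ℝ := fun z =>
    (1 - (z.1 : ℝ)) • (f z.2).1 + (z.1 : ℝ) • (g z.2).1
  have hc1 : ∀ z, ((c z).sum fun _ r => r) = 1 := by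
    intro z
    simp only [c]
    rw [Finsupp.sum_add_index' (fun _ => rfl) (fun _ _ _ => rfl),
      Finsupp.sum_smul_index (fun _ => rfl), Finsupp.sum_smul_index (fun _ => rfl),
      ← Finsupp.mul_sum, ← Finsupp.mul_sum, (f z.2).2.2.2, (g z.2).2.2.2]
    ring
  have hcs : ∀ z, (c z).support ∈ K.faces := by
    intro z
    obtain ⟨s, hs, h1, h2⟩ := hfg z.2
    refine Realization.support_mem hs ?_ (hc1 z)
    refine Finsupp.support_add.trans (Finset.union_subset ?_ ?_)
    · exact Finsupp.support_smul.trans h1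
    · exact Finsupp.support_smul.trans h2
  have hc0 : ∀ z v, 0 ≤ c z v := by
    intro z v
    simp only [c, Finsupp.add_apply, Finsupp.smul_apply, smul_eq_mul]
    exact add_nonneg (mul_nonneg (sub_nonneg.2 z.1.2.2) ((f z.2).2.1 v))
      (mul_nonneg z.1.2.1 ((g z.2).2.1 v))
  let H : unitInterval × Y → Realization K := fun z => ⟨c z, hc0 z, hcs z, hc1 z⟩
  have hHc : Continuous H := by
    refine Realization.continuous_of_coord H (fun v => ?_) ?_
    · change Continuous fun z : unitInterval × Y => c z v
      simp only [c, Finsupp.add_apply, Finsupp.smul_apply, smul_eq_mul]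
      have h1 := (Realization.continuous_coord K v).comp (f.continuous.comp continuous_snd)
        (X := unitInterval × Y)
      have h2 := (Realization.continuous_coord K v).comp (g.continuous.comp continuous_snd)
        (X := unitInterval × Y)
      exact ((continuous_const.sub (continuous_subtype_val.comp continuous_fst)).mul h1).add
        ((continuous_subtype_val.comp continuous_fst).mul h2)
    · refine (hlf.preimage_continuous continuous_snd).subset fun v z hz => ?_
      by_contra hne
      simp only [Set.mem_preimage, Set.mem_ofPred_eq, not_or, not_not] at hne
      apply hz
      change c z v = 0
      simp [c, hne.1, hne.2]
  have hH0 : ∀ y, H (0, y) = f y := fun y => Subtype.ext (by simp [H, c])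
  have hH1 : ∀ y, H (1, y) = g y := fun y => Subtype.ext (by simp [H, c])
  have hHp : ∀ t, H (t, y₀) = p := fun t => Subtype.ext (by
    simp only [H, c, hf, hg, ← add_smul]
    simp)
  ext a
  induction a using Quotient.inductionOn with
  | h a =>
    refine Quotient.sound ⟨⟨⟨⟨fun z => H (z.1, a z.2), ?_⟩, fun t => hH0 _, fun t => hH1 _⟩, ?_⟩⟩
    · exact hHc.comp (continuous_fst.prodMk (a.1.continuous.comp continuous_snd))
    · intro t x hx
      have hax : a x = y₀ := a.2 x hx
      change H (t, a x) = f (a x)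
      rw [hax, hHp, hf]

end Realization

/-! ### The shape topology -/

section Shape

variable {X : Type*} [TopologicalSpace X]

/-- The nerve of a family `𝒰` of subsets of `X`: its vertices are the members of `𝒰`, and finitely
many members span a simplex iff their intersection is nonempty. -/
def nerve (𝒰 : Set (Set X)) : PreAbstractSimplicialComplex 𝒰 where
  faces := {s | s.Nonempty ∧ ∃ x : X, ∀ U ∈ s, x ∈ U.1}
  isRelLowerSet_faces := by
    rintro s ⟨hs, x, hx⟩
    exact ⟨hs, fun t hts ht => ⟨ht, x, fun U hU => hx U (hts hU)⟩⟩

/-- The index set `cov(X)` of pairs `(𝒰, U₀)`: a locally finite open cover `𝒰` of `X` and a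
distinguished member `U₀` that contains `x₀`, for which a pointed canonical map `X → |N(𝒰)|`
exists, that is, a partition of unity subordinate to `𝒰` whose `U₀`-th function is `1` at `x₀`. -/
structure PointedCover (X : Type*) [TopologicalSpace X] (x₀ : X) where
  /-- the open cover -/
  cover : Set (Set X)
  isOpenCover : IsOpenCover cover
  locallyFinite : LocallyFinite (Subtype.val : cover → Set X)
  /-- the distinguished member -/
  base : cover
  mem_base : x₀ ∈ base.1
  exists_partition : ∃ φ : PartitionOfUnity cover X Set.univ,
    φ.IsSubordinate Subtype.val ∧ φ base x₀ = 1

/-- In a paracompact Hausdorff space, the partition of unity required in `PointedCover` exists for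
every open cover and every distinguished member containing `x₀`. -/
theorem exists_partition_of_paracompact [T2Space X] [ParacompactSpace X] {x₀ : X}
    {𝒰 : Set (Set X)} (h𝒰 : IsOpenCover 𝒰) (U₀ : 𝒰) (h₀ : x₀ ∈ U₀.1) :
    ∃ φ : PartitionOfUnity 𝒰 X Set.univ, φ.IsSubordinate Subtype.val ∧ φ U₀ x₀ = 1 := by
  classical
  let W : 𝒰 → Set X := fun U => if U = U₀ then U.1 else U.1 \ {x₀}
  have hWU : ∀ U, W U ⊆ U.1 := by
    intro U
    simp only [W]
    split_ifs
    · exact subset_rfl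
    · exact Set.sdiff_subset
  have hWo : ∀ U, IsOpen (W U) := by
    intro U
    simp only [W]
    split_ifs
    · exact h𝒰.isOpen _ U.2
    · exact (h𝒰.isOpen _ U.2).sdiff isClosed_singleton
  have hWc : Set.univ ⊆ ⋃ U, W U := by
    intro x _
    by_cases hx : x = x₀
    · exact Set.mem_iUnion.2 ⟨U₀, by simpa [W, hx] using h₀⟩
    · have h1 : x ∈ ⋃₀ 𝒰 := h𝒰.covers ▸ Set.mem_univ x
      obtain ⟨U, hU, hxU⟩ := h1
      refine Set.mem_iUnion.2 ⟨⟨U, hU⟩, ?_⟩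
      simp only [W]
      split_ifs
      · exact hxU
      · exact ⟨hxU, hx⟩
  obtain ⟨φ, hφ⟩ := PartitionOfUnity.exists_isSubordinate isClosed_univ W hWo hWc
  refine ⟨φ, fun U => (hφ U).trans (hWU U), ?_⟩
  have h2 := φ.sum_eq_one (Set.mem_univ x₀)
  rwa [finsum_eq_single _ U₀ fun U hU => ?_] at h2
  by_contra hne
  have h3 : x₀ ∈ W U := hφ U (subset_tsupport _ hne)
  simp [W, hU] at h3

namespace PointedCover

variable {x₀ : X}

/-- The polyhedron `|N(𝒰)|`. -/
abbrev polyhedron (𝒰 : PointedCover X x₀) : Type _ := Realization (nerve 𝒰.cover)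

/-- The base point of `|N(𝒰)|`: the vertex `U₀`. -/
def basePoint (𝒰 : PointedCover X x₀) : 𝒰.polyhedron :=
  Realization.vertex (nerve 𝒰.cover) 𝒰.base
    ⟨Finset.singleton_nonempty _, x₀, fun _ hU => Finset.mem_singleton.1 hU ▸ 𝒰.mem_base⟩

/-- A partition of unity as in the definition of `PointedCover`. -/
def partition (𝒰 : PointedCover X x₀) : PartitionOfUnity 𝒰.cover X Set.univ :=
  𝒰.exists_partition.choose

theorem partition_mem (𝒰 : PointedCover X x₀) {U : 𝒰.cover} {x : X} (h : 𝒰.partition U x ≠ 0) :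
    x ∈ U.1 :=
  𝒰.exists_partition.choose_spec.1 U (subset_tsupport _ h)

theorem partition_base (𝒰 : PointedCover X x₀) : 𝒰.partition 𝒰.base x₀ = 1 :=
  𝒰.exists_partition.choose_spec.2

/-- The canonical map `p_𝒰 : X → |N(𝒰)|`: the barycentric coordinates of `p_𝒰(x)` are the values
at `x` of the functions of the partition of unity. Up to homotopy relative to `x₀` it does not
depend on the partition of unity. -/
def canonicalMap (𝒰 : PointedCover X x₀) : C(X, 𝒰.polyhedron) where
  toFun x := ⟨Finsupp.ofSupportFinite (fun U => 𝒰.partition U x)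
      (𝒰.partition.locallyFinite.point_finite x), by
    have h1 : ((Finsupp.ofSupportFinite (fun U => 𝒰.partition U x)
        (𝒰.partition.locallyFinite.point_finite x)).sum fun _ r => r) = 1 := by
      rw [← 𝒰.partition.sum_eq_one (Set.mem_univ x), finsum_eq_sum _
        (𝒰.partition.locallyFinite.point_finite x)]
      rfl
    refine ⟨fun U => 𝒰.partition.nonneg U x, ⟨?_, x, fun U hU => ?_⟩, h1⟩
    · rw [Finset.nonempty_iff_ne_empty]
      intro h
      rw [Finsupp.support_eq_empty] at h
      rw [h] at h1
      simp at h1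
    · exact 𝒰.partition_mem (Finsupp.mem_support_iff.1 hU)⟩
  continuous_toFun :=
    Realization.continuous_of_coord _ (fun U => (𝒰.partition U).continuous)
      𝒰.partition.locallyFinite

theorem canonicalMap_base (𝒰 : PointedCover X x₀) : 𝒰.canonicalMap x₀ = 𝒰.basePoint := by
  classical
  have hs := 𝒰.partition.sum_finsupport (Set.mem_univ x₀)
  refine Subtype.ext (Finsupp.ext fun U => ?_)
  change 𝒰.partition U x₀ = Finsupp.single 𝒰.base (1 : ℝ) U
  rw [Finsupp.single_apply]
  split_ifs with h
  · rw [← h, 𝒰.partition_base]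
  · have h2 := 𝒰.partition.sum_finsupport' (Set.mem_univ x₀)
      (I := 𝒰.partition.finsupport x₀ ∪ {𝒰.base, U}) Finset.subset_union_left
    have h3 : ∑ i ∈ {𝒰.base, U}, 𝒰.partition i x₀ ≤
        ∑ i ∈ 𝒰.partition.finsupport x₀ ∪ {𝒰.base, U}, 𝒰.partition i x₀ :=
      Finset.sum_le_sum_of_subset_of_nonneg Finset.subset_union_right
        fun i _ _ => 𝒰.partition.nonneg i x₀
    rw [h2, Finset.sum_pair h, 𝒰.partition_base] at h3
    linarith [𝒰.partition.nonneg U x₀]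

/-- A refinement projection from `(𝒱, V₀)` to `(𝒰, U₀)`: a choice, for each `V ∈ 𝒱`, of a member
of `𝒰` that contains `V`, with `V₀` sent to `U₀`. The pair `(𝒱, V₀)` refines `(𝒰, U₀)` iff
there is such a choice. -/
structure IsProjection (𝒱 𝒰 : PointedCover X x₀) (r : 𝒱.cover → 𝒰.cover) : Prop where
  subset : ∀ V, V.1 ⊆ (r V).1
  base : r 𝒱.base = 𝒰.base

theorem IsProjection.image_mem {𝒱 𝒰 : PointedCover X x₀} {r : 𝒱.cover → 𝒰.cover}
    [DecidableEq 𝒰.cover] (hr : IsProjection 𝒱 𝒰 r) :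
    ∀ s ∈ (nerve 𝒱.cover).faces, s.image r ∈ (nerve 𝒰.cover).faces := by
  rintro s ⟨hs, x, hx⟩
  refine ⟨hs.image r, x, fun U hU => ?_⟩
  obtain ⟨V, hV, rfl⟩ := Finset.mem_image.1 hU
  exact hr.subset V (hx V hV)

/-- The simplicial map `p_{𝒰𝒱} : |N(𝒱)| → |N(𝒰)|` given by a refinement projection. -/
def bondingMap {𝒱 𝒰 : PointedCover X x₀} {r : 𝒱.cover → 𝒰.cover} (hr : IsProjection 𝒱 𝒰 r) :
    C(𝒱.polyhedron, 𝒰.polyhedron) :=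
  Realization.map r (@IsProjection.image_mem _ _ _ _ _ _ (Classical.decEq _) hr)

theorem bondingMap_base {𝒱 𝒰 : PointedCover X x₀} {r : 𝒱.cover → 𝒰.cover}
    (hr : IsProjection 𝒱 𝒰 r) : bondingMap hr 𝒱.basePoint = 𝒰.basePoint := by
  refine Subtype.ext ?_
  change Finsupp.mapDomain r (Finsupp.single 𝒱.base 1) = Finsupp.single 𝒰.base 1
  rw [Finsupp.mapDomain_single, hr.base]

end PointedCover

open PointedCover

/-- The homomorphism `p_{𝒰#} : π_n(X,x₀) → π_n(|N(𝒰)|,U₀)`. -/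
def canonicalHom (n : ℕ) [NeZero n] {x₀ : X} (𝒰 : PointedCover X x₀) :
    π_ n X x₀ →* π_ n 𝒰.polyhedron 𝒰.basePoint :=
  inducedHom n 𝒰.canonicalMap 𝒰.canonicalMap_base

/-- The homomorphism `p_{𝒰𝒱#} : π_n(|N(𝒱)|,V₀) → π_n(|N(𝒰)|,U₀)`. -/
def bondingHom (n : ℕ) [NeZero n] {x₀ : X} {𝒱 𝒰 : PointedCover X x₀} {r : 𝒱.cover → 𝒰.cover}
    (hr : IsProjection 𝒱 𝒰 r) : π_ n 𝒱.polyhedron 𝒱.basePoint →* π_ n 𝒰.polyhedron 𝒰.basePoint :=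
  inducedHom n (bondingMap hr) (bondingMap_base hr)

theorem bondingHom_canonicalHom (n : ℕ) [NeZero n] {x₀ : X} {𝒱 𝒰 : PointedCover X x₀}
    {r : 𝒱.cover → 𝒰.cover} (hr : IsProjection 𝒱 𝒰 r) (a : π_ n X x₀) :
    bondingHom n hr (canonicalHom n 𝒱 a) = canonicalHom n 𝒰 a := by
  classical
  let f : C(X, 𝒰.polyhedron) := (bondingMap hr).comp 𝒱.canonicalMap
  have hf : f x₀ = 𝒰.basePoint := by
    change bondingMap hr (𝒱.canonicalMap x₀) = _
    rw [𝒱.canonicalMap_base, bondingMap_base]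
  have hfm : ∀ x U, (f x).1 U ≠ 0 → x ∈ U.1 := by
    intro x U hU
    have h1 : U ∈ (Finsupp.mapDomain r (𝒱.canonicalMap x).1).support :=
      Finsupp.mem_support_iff.2 hU
    obtain ⟨V, hV, rfl⟩ := Finset.mem_image.1 (Finsupp.mapDomain_support h1)
    exact hr.subset V (𝒱.partition_mem (Finsupp.mem_support_iff.1 hV))
  have hgm : ∀ x U, (𝒰.canonicalMap x).1 U ≠ 0 → x ∈ U.1 := fun x U hU => 𝒰.partition_mem hU
  have key : inducedHom n f hf = canonicalHom n 𝒰 := by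
    refine inducedHom_eq_of_contiguous n f 𝒰.canonicalMap hf 𝒰.canonicalMap_base ?_ ?_
    · refine 𝒰.locallyFinite.subset fun U x hx => ?_
      rcases hx with hx | hx
      · exact hfm x U hx
      · exact hgm x U hx
    · intro x
      refine ⟨(f x).1.support ∪ (𝒰.canonicalMap x).1.support, ⟨?_, x, fun U hU => ?_⟩,
        Finset.subset_union_left, Finset.subset_union_right⟩
      · exact Finset.Nonempty.mono Finset.subset_union_left (f x).2.2.1.1
      · rcases Finset.mem_union.1 hU with hU | hU
        · exact hfm x U (Finsupp.mem_support_iff.1 hU)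
        · exact hgm x U (Finsupp.mem_support_iff.1 hU)
  rw [← key]
  induction a using Quotient.inductionOn with
  | h a => rfl

/-- The `n`-th shape homotopy group: the limit of the inverse system of the groups
`π_n(|N(𝒰)|,U₀)` and the homomorphisms `p_{𝒰𝒱#}`. -/
def shapeGroup (n : ℕ) [NeZero n] (x₀ : X) :
    Subgroup (∀ 𝒰 : PointedCover X x₀, π_ n 𝒰.polyhedron 𝒰.basePoint) where
  carrier := {g | ∀ (𝒱 𝒰 : PointedCover X x₀) (r : 𝒱.cover → 𝒰.cover) (hr : IsProjection 𝒱 𝒰 r),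
    bondingHom n hr (g 𝒱) = g 𝒰}
  mul_mem' := by
    intro a b ha hb 𝒱 𝒰 r hr
    rw [Pi.mul_apply, Pi.mul_apply, map_mul, ha, hb]
  one_mem' := by
    intro 𝒱 𝒰 r hr
    rw [Pi.one_apply, Pi.one_apply, map_one]
  inv_mem' := by
    intro a ha 𝒱 𝒰 r hr
    rw [Pi.inv_apply, Pi.inv_apply, map_inv, ha]

/-- The inverse limit topology on the shape homotopy group, where each `π_n(|N(𝒰)|,U₀)` is
discrete. -/
abbrev shapeGroupTopology (n : ℕ) [NeZero n] (x₀ : X) : TopologicalSpace (shapeGroup n x₀) :=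
  TopologicalSpace.induced Subtype.val
    (@Pi.topologicalSpace (PointedCover X x₀) (fun 𝒰 => π_ n 𝒰.polyhedron 𝒰.basePoint) fun _ => ⊥)

/-- The canonical homomorphism `Ψ_n : π_n(X,x₀) → π̌_n(X,x₀)`, `[α] ↦ ([p_𝒰 ∘ α])_𝒰`. -/
def shapeHom (n : ℕ) [NeZero n] (x₀ : X) : π_ n X x₀ →* shapeGroup n x₀ :=
  (MonoidHom.pi fun 𝒰 => canonicalHom n 𝒰).codRestrict (shapeGroup n x₀)
    fun a _ _ _ hr => bondingHom_canonicalHom n hr a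

/-- The shape topology on `π_n(X,x₀)`: the initial topology with respect to `Ψ_n`. -/
abbrev shapeTopology (n : ℕ) [NeZero n] (x₀ : X) : TopologicalSpace (π_ n X x₀) :=
  TopologicalSpace.induced (shapeHom n x₀) (shapeGroupTopology n x₀)

end Shape

end TopHomotopy

end

/-!
Each comparison reduces to one of subgroups (`NbhdFamily.isCoarser_of_forall_exists_le`): a subgroup
topology becomes finer when every subgroup of one family contains a subgroup of the other.

* The path Spanier topology refines the Spanier topology, because every open cover yields a path
  open cover by a choice of members that contain the end points of the paths.
* The Spanier subgroup of a cover is contained in the thick one. A loop in a member of the cover is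
  a map on the sphere, because the cube modulo its boundary is a sphere (`exists_isCollapse`), and
  its restrictions to the two hemispheres are the two discs (`isThick_of_range_subset`).
* The thick Spanier subgroup of a cover is contained in the weak thick one by definition.
* The shape topology is generated by the left cosets of the kernels of the homomorphisms `p_𝒰#`.
  Given a partition of unity `φ` subordinate to `𝒰`, there is an open cover
  (`PointedCover.controlledCover`) so fine that on the union of any two intersecting members some
  `φ_U` is positive. An `n`-loop `v` in the union of two members lies in one of them if they are
  disjoint, the cube being connected; in either case some `φ_U` is positive on `v`. Then `p_𝒰 ∘ v`
  lies in the open star of the vertex `U` and contracts to it along straight lines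
  (`Realization.exists_contraction_to_vertex`). The contraction moves the base point, but a loop that
  is contractible in this sense is null homotopic relative to the boundary
  (`homotopic_const_of_homotopicWith`). Hence `p_𝒰#` annihilates `σ_#[v]`, and the kernel of `p_𝒰#`
  contains the weak thick Spanier subgroup of the cover.
-/

namespace TopHomotopy

/-! ### Comparison of subgroup topologies -/

theorem NbhdFamily.isOpen_of_forall_smul_subset {G : Type*} [Group G] (F : NbhdFamily G)
    {H : Subgroup G} (hH : H ∈ F.carrier) {s : Set G} (hs : ∀ g ∈ s, g • (H : Set G) ⊆ s) :
    IsOpen[F.topology] s := by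
  have h : s = ⋃ g ∈ s, g • (H : Set G) := by
    refine Set.Subset.antisymm (fun g hg => ?_) (Set.iUnion₂_subset hs)
    exact Set.mem_biUnion hg (Set.mem_smul_set.2 ⟨1, H.one_mem, mul_one g⟩)
  rw [h]
  let := F.topology
  exact isOpen_biUnion fun g _ => TopologicalSpace.isOpen_generateFrom_of_mem ⟨H, hH, g, rfl⟩

/-- Topologies are compared by comparing the subgroups: every left coset of `H` is a union of left
cosets of a smaller subgroup. -/
theorem NbhdFamily.isCoarser_of_forall_exists_le {G : Type*} [Group G] {F F' : NbhdFamily G}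
    (h : ∀ H ∈ F.carrier, ∃ K ∈ F'.carrier, K ≤ H) : F.topology ≼ₜ F'.topology := by
  suffices F'.topology ≤ F.topology from this
  refine le_generateFrom ?_
  rintro _ ⟨H, hH, g, rfl⟩
  obtain ⟨K, hK, hKH⟩ := h H hH
  refine F'.isOpen_of_forall_smul_subset hK ?_
  rintro _ ⟨a, ha, rfl⟩ _ ⟨k, hk, rfl⟩
  exact ⟨a * k, H.mul_mem ha (hKH hk), by simp [mul_assoc]⟩

/-- The image of `f₁ ⊛ f₂` lies in the union of the two members of the cover that contain the
images of `f₁` and `f₂`, so for one and the same cover the thick Spanier subgroup is contained in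
the weak thick one. -/
theorem weakThickSpanierTopology_isCoarser {X : Type*} [TopologicalSpace X] (x₀ : X) (n : ℕ)
    [NeZero n] : weakThickSpanierTopology n x₀ ≼ₜ thickSpanierTopology n x₀ := by
  refine NbhdFamily.isCoarser_of_forall_exists_le ?_
  rintro _ ⟨𝒰, h𝒰, rfl⟩
  refine ⟨_, ⟨𝒰, h𝒰, rfl⟩, transportSubgroup_mono ?_⟩
  rintro y σ v ⟨q, s₀, f₁, f₂, -, -, -, -, -, ⟨U₁, hU₁, h₁⟩, ⟨U₂, hU₂, h₂⟩, hv⟩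
  refine ⟨U₁, hU₁, U₂, hU₂, ?_⟩
  rintro _ ⟨t, rfl⟩
  rw [hv, discUnion]
  split_ifs
  · exact Or.inl (h₁ ⟨_, rfl⟩)
  · exact Or.inr (h₂ ⟨_, rfl⟩)

/-- Assigning to each path a member of an open cover that contains its end point gives a path open
cover whose path Spanier subgroup is contained in the Spanier subgroup of the cover. -/
theorem spanierTopology_isCoarser {X : Type*} [TopologicalSpace X] (x₀ : X) (n : ℕ)
    [NeZero n] : spanierTopology n x₀ ≼ₜ pathSpanierTopology n x₀ := by
  refine NbhdFamily.isCoarser_of_forall_exists_le ?_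
  rintro _ ⟨𝒰, h𝒰, rfl⟩
  have h : ∀ y : X, ∃ U ∈ 𝒰, y ∈ U := fun y => by
    rw [← Set.mem_sUnion, h𝒰.covers]
    trivial
  choose U hU hyU using h
  refine ⟨_, ⟨⟨fun {y} _ => U y, fun _ => h𝒰.isOpen _ (hU _), fun _ => hyU _⟩, rfl⟩,
    transportSubgroup_mono ?_⟩
  intro y σ v hv
  exact ⟨U y, hU y, hv⟩

/-! ### The cube modulo its boundary -/

/-- The collapse of the complement of an open subspace `V` of a Hausdorff space `K` to the point at
infinity of the one-point compactification of `V`. -/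
theorem continuous_extend_infty {V K : Type*} [TopologicalSpace V] [TopologicalSpace K] [T2Space K]
    {e : V → K} (he : Topology.IsOpenEmbedding e) :
    Continuous (Function.extend e ((↑) : V → OnePoint V) fun _ => OnePoint.infty) := by
  refine ⟨fun s hs => ?_⟩
  rw [OnePoint.isOpen_def] at hs
  by_cases h : OnePoint.infty ∈ s
  · have h1 : (Function.extend e ((↑) : V → OnePoint V) fun _ => OnePoint.infty) ⁻¹' s =
        (e '' ((↑) ⁻¹' s : Set V)ᶜ)ᶜ := by
      ext x
      by_cases hx : ∃ a, e a = x
      · obtain ⟨a, rfl⟩ := hx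
        simp [he.injective.extend_apply, he.injective.eq_iff]
      · simp only [Set.mem_preimage, Function.extend_apply' _ _ _ hx, h, Set.mem_compl_iff, true_iff]
        rintro ⟨a, -, ha⟩
        exact hx ⟨a, ha⟩
    rw [h1]
    exact ((hs.1 h).image he.continuous).isClosed.isOpen_compl
  · have h1 : (Function.extend e ((↑) : V → OnePoint V) fun _ => OnePoint.infty) ⁻¹' s =
        e '' ((↑) ⁻¹' s : Set V) := by
      ext x
      by_cases hx : ∃ a, e a = x
      · obtain ⟨a, rfl⟩ := hx
        simp [he.injective.extend_apply, he.injective.eq_iff]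
      · simp only [Set.mem_preimage, Function.extend_apply' _ _ _ hx, h, false_iff]
        rintro ⟨a, -, ha⟩
        exact hx ⟨a, ha⟩
    rw [h1]
    exact he.isOpenMap _ hs.2

/-- The parametrization of the open cube by `ℝⁿ`, with the sigmoid function in each coordinate. -/
noncomputable def cubeChart (n : ℕ) (x : Fin n → ℝ) : Fin n → unitInterval :=
  fun i => unitInterval.sigmoid (x i)

theorem range_cubeChart (n : ℕ) : Set.range (cubeChart n) = (Cube.boundary (Fin n))ᶜ := by
  ext t
  have h : ∀ i, (∃ x, unitInterval.sigmoid x = t i) ↔ 0 < t i ∧ t i < 1 := fun i => by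
    rw [← Set.mem_Ioo, ← unitInterval.range_sigmoid, Set.mem_range]
  have h1 : t ∈ Set.range (cubeChart n) ↔ ∀ i, ∃ x, unitInterval.sigmoid x = t i := by
    constructor
    · rintro ⟨x, rfl⟩ i
      exact ⟨x i, rfl⟩
    · intro h
      choose x hx using h
      exact ⟨x, funext hx⟩
  rw [h1]
  simp only [h, Cube.boundary, Set.mem_compl_iff, Set.mem_ofPred_eq, not_exists, not_or,
    unitInterval.pos_iff_ne_zero, unitInterval.lt_one_iff_ne_one, ne_eq]

theorem isClosed_cubeBoundary (n : ℕ) : IsClosed (Cube.boundary (Fin n)) := by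
  have h : Cube.boundary (Fin n) = ⋃ i, {t | t i = 0} ∪ {t | t i = 1} := by
    ext t
    simp [Cube.boundary]
  rw [h]
  exact isClosed_iUnion_of_finite fun i =>
    (isClosed_eq (continuous_apply i) continuous_const).union
      (isClosed_eq (continuous_apply i) continuous_const)

theorem isOpenEmbedding_cubeChart (n : ℕ) : Topology.IsOpenEmbedding (cubeChart n) := by
  refine ⟨Topology.IsEmbedding.piMap fun _ => Topology.isEmbedding_sigmoid, ?_⟩
  rw [range_cubeChart]
  exact (isClosed_cubeBoundary n).isOpen_compl

/-- Every point of the sphere is the image of `∂Iⁿ` under some identification of `Iⁿ / ∂Iⁿ` with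
the sphere: the open cube is homeomorphic to `ℝⁿ`, whose one-point compactification is the sphere
by stereographic projection from the given point. -/
theorem exists_isCollapse {n : ℕ} (s₀ : Sph n) :
    ∃ q : C(Fin n → unitInterval, Sph n), IsCollapse q s₀ := by
  have hs : ‖s₀.1‖ = 1 := by simp
  have hs' : s₀.1 ≠ 0 := fun h => by simp [h] at hs
  let E := EuclideanSpace ℝ (Fin (n + 1))
  have : Fact (Module.finrank ℝ E = n + 1) := ⟨by simp [E]⟩
  have hV : Module.finrank ℝ (Fin n → ℝ) = Module.finrank ℝ (ℝ ∙ s₀.1)ᗮ := by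
    rw [Module.finrank_fin_fun]
    exact (Submodule.finrank_orthogonal_span_singleton hs').symm
  let e : (Fin n → ℝ) ≃ₜ (ℝ ∙ s₀.1)ᗮ :=
    (FiniteDimensional.nonempty_continuousLinearEquiv_of_finrank_eq hV).some.toHomeomorph
  let φ : OnePoint (Fin n → ℝ) ≃ₜ Sph n :=
    e.onePointCongr.trans (onePointHyperplaneHomeoUnitSphere hs)
  have hφ : φ OnePoint.infty = s₀ := rfl
  let c : (Fin n → unitInterval) → OnePoint (Fin n → ℝ) :=
    Function.extend (cubeChart n) (↑) fun _ => OnePoint.infty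
  have hc : ∀ x, c (cubeChart n x) = x := (isOpenEmbedding_cubeChart n).injective.extend_apply _ _
  refine ⟨⟨fun t => φ (c t),
    φ.continuous.comp (continuous_extend_infty (isOpenEmbedding_cubeChart n))⟩, ?_, ?_⟩
  · intro t ht
    have : ¬ ∃ x, cubeChart n x = t := fun h => by
      have : t ∈ Set.range (cubeChart n) := h
      rw [range_cubeChart] at this
      exact this ht
    change φ (c t) = s₀
    rw [← hφ]
    exact congrArg φ (Function.extend_apply' _ _ _ this)
  · rw [← range_cubeChart]
    refine ⟨?_, ?_, ?_⟩
    · rintro _ ⟨x, rfl⟩ (h : φ (c (cubeChart n x)) = s₀)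
      rw [hc, ← hφ] at h
      exact OnePoint.coe_ne_infty x (φ.injective h)
    · rintro _ ⟨x, rfl⟩ _ ⟨y, rfl⟩ (h : φ (c (cubeChart n x)) = φ (c (cubeChart n y)))
      rw [hc, hc] at h
      rw [OnePoint.coe_injective (φ.injective h)]
    · intro z hz
      obtain ⟨w, rfl⟩ := φ.surjective z
      induction w using OnePoint.rec with
      | infty => exact absurd hφ hz
      | coe x => exact ⟨_, ⟨x, rfl⟩, congrArg φ (hc x)⟩

/-- An `n`-loop is a map on the sphere, since the identification `q` is a quotient map (a continuous
surjection from a compact space onto a Hausdorff space). -/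
theorem IsCollapse.exists_factor {X : Type*} [TopologicalSpace X] {n : ℕ} [NeZero n]
    {q : C(Fin n → unitInterval, Sph n)} {s₀ : Sph n} (hq : IsCollapse q s₀) {y : X}
    (v : GenLoop (Fin n) X y) : ∃ g : C(Sph n, X), ∀ t, g (q t) = v t := by
  have hsurj : Function.Surjective q := by
    intro z
    by_cases hz : z = s₀
    · exact ⟨0, (hq.boundary 0 ⟨0, Or.inl rfl⟩).trans hz.symm⟩
    · obtain ⟨t, -, ht⟩ := hq.bijOn.surjOn hz
      exact ⟨t, ht⟩
  have hqm : Topology.IsQuotientMap q := .of_surjective_continuous hsurj q.continuous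
  have hfac : Function.FactorsThrough v.1 q := by
    intro a b hab
    change v a = v b
    by_cases ha : a ∈ Cube.boundary (Fin n) <;> by_cases hb : b ∈ Cube.boundary (Fin n)
    · rw [GenLoop.boundary v a ha, GenLoop.boundary v b hb]
    · exact absurd (hab.symm.trans (hq.boundary a ha)) (hq.bijOn.mapsTo hb)
    · exact absurd (hab.trans (hq.boundary b hb)) (hq.bijOn.mapsTo ha)
    · rw [hq.bijOn.injOn ha hb hab]
  exact ⟨hqm.lift v.1 hfac, DFunLike.congr_fun (hqm.lift_comp v.1 hfac)⟩

/-- The section of the vertical projection `Sⁿ → Dⁿ` over the upper (`ε = 1`) or lower (`ε = -1`)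
hemisphere. -/
noncomputable def Disc.toSph {n : ℕ} (ε : ℝ) (hε : ε ^ 2 = 1) : C(Disc n, Sph n) where
  toFun x := ⟨WithLp.toLp 2 (Fin.snoc (α := fun _ => ℝ) x.1 (ε * √(1 - ‖x.1‖ ^ 2))), by
    have hx : ‖x.1‖ ≤ 1 := mem_closedBall_zero_iff.1 x.2
    have h1 : 0 ≤ 1 - ‖x.1‖ ^ 2 := by nlinarith [norm_nonneg x.1]
    rw [mem_sphere_zero_iff_norm, ← sq_eq_sq₀ (norm_nonneg _) zero_le_one,
      EuclideanSpace.norm_sq_eq, Fin.sum_univ_castSucc]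
    simp only [Fin.snoc_castSucc, Fin.snoc_last, ← EuclideanSpace.norm_sq_eq]
    rw [Real.norm_eq_abs, sq_abs, mul_pow, hε, Real.sq_sqrt h1]
    ring⟩
  continuous_toFun := by
    refine Continuous.subtype_mk ((PiLp.continuous_toLp 2 _).comp (continuous_pi fun i => ?_)) _
    refine Fin.lastCases ?_ (fun j => ?_) i
    · simp only [Fin.snoc_last]
      fun_prop
    · simp only [Fin.snoc_castSucc]
      fun_prop

/-- The hypothesis on the height says that `z` lies on the hemisphere of sign `ε`. -/
theorem Disc.toSph_toDisc {n : ℕ} {ε : ℝ} (hε : ε ^ 2 = 1) (z : Sph n)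
    (hz : z.height = ε * |z.height|) : Disc.toSph ε hε z.toDisc = z := by
  have h1 : ‖z.1‖ ^ 2 = 1 := by simp
  rw [EuclideanSpace.norm_sq_eq, Fin.sum_univ_castSucc] at h1
  have h2 : ‖z.toDisc.1‖ ^ 2 = ∑ i : Fin n, ‖z.1 i.castSucc‖ ^ 2 := EuclideanSpace.norm_sq_eq _
  have h3 : 1 - ‖z.toDisc.1‖ ^ 2 = z.height ^ 2 := by
    rw [Real.norm_eq_abs (z.1 (Fin.last n)), sq_abs] at h1
    rw [h2, Sph.height]
    linarith
  refine Subtype.ext (PiLp.ext fun i => ?_)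
  change Fin.snoc (α := fun _ => ℝ) z.toDisc.1 (ε * √(1 - ‖z.toDisc.1‖ ^ 2)) i = z.1 i
  rw [h3, Real.sqrt_sq_eq_abs, ← hz]
  refine Fin.lastCases ?_ (fun j => ?_) i
  · rw [Fin.snoc_last]
    rfl
  · rw [Fin.snoc_castSucc]
    rfl

/-- A loop in a single member `U` of the cover is `f₁ ⊛ f₂` for its own restrictions `f₁`, `f₂` to the
two hemispheres, both with image in `U`. -/
theorem isThick_of_range_subset {X : Type*} [TopologicalSpace X] {n : ℕ} [NeZero n] {y : X}
    {𝒰 : Set (Set X)} {U : Set X} (hU : U ∈ 𝒰) (v : GenLoop (Fin n) X y)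
    (hv : Set.range v ⊆ U) : IsThick 𝒰 v := by
  let s₀ : Sph n := ⟨EuclideanSpace.single (Fin.castSucc 0) 1, by simp⟩
  have h0 : s₀.height = 0 := by
    simp only [Sph.height, s₀]
    exact PiLp.single_eq_of_ne _ (Fin.castSucc_lt_last _).ne' _
  obtain ⟨q, hq⟩ := exists_isCollapse s₀
  obtain ⟨g, hg⟩ := hq.exists_factor v
  have hgs : g s₀ = y := by
    have hb : (0 : Fin n → unitInterval) ∈ Cube.boundary (Fin n) := ⟨0, Or.inl rfl⟩
    rw [← hq.boundary 0 hb, hg, GenLoop.boundary v 0 hb]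
  have hgU : ∀ z, g z ∈ U := fun z => by
    by_cases hz : z = s₀
    · rw [hz, hgs, ← GenLoop.boundary v 0 ⟨0, Or.inl rfl⟩]
      exact hv ⟨0, rfl⟩
    · obtain ⟨t, -, rfl⟩ := hq.bijOn.surjOn hz
      rw [hg]
      exact hv ⟨t, rfl⟩
  have h1 : (1 : ℝ) ^ 2 = 1 := by norm_num
  have h2 : (-1 : ℝ) ^ 2 = 1 := by norm_num
  refine ⟨q, s₀, g.comp (Disc.toSph 1 h1), g.comp (Disc.toSph (-1) h2), h0, hq, ?_, ?_, ?_,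
    ⟨U, hU, ?_⟩, ⟨U, hU, ?_⟩, fun t => ?_⟩
  · change g (Disc.toSph 1 h1 s₀.toDisc) = y
    rw [Disc.toSph_toDisc h1 s₀ (by simp [h0]), hgs]
  · change g (Disc.toSph (-1) h2 s₀.toDisc) = y
    rw [Disc.toSph_toDisc h2 s₀ (by simp [h0]), hgs]
  · intro x hx
    refine congrArg g (Subtype.ext ?_)
    simp [Disc.toSph, hx]
  · rintro _ ⟨x, rfl⟩
    exact hgU _
  · rintro _ ⟨x, rfl⟩
    exact hgU _
  · rw [← hg, discUnion]
    split_ifs with h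
    · change g (q t) = g (Disc.toSph 1 h1 (q t).toDisc)
      rw [Disc.toSph_toDisc h1 _ (by rw [abs_of_nonneg h, one_mul])]
    · change g (q t) = g (Disc.toSph (-1) h2 (q t).toDisc)
      rw [Disc.toSph_toDisc h2 _ (by rw [abs_of_neg (not_le.1 h)]; ring)]

/-- For one and the same cover, the Spanier subgroup is contained in the thick Spanier subgroup. -/
theorem thickSpanierTopology_isCoarser {X : Type*} [TopologicalSpace X] (x₀ : X) (n : ℕ)
    [NeZero n] : thickSpanierTopology n x₀ ≼ₜ spanierTopology n x₀ := by
  refine NbhdFamily.isCoarser_of_forall_exists_le ?_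
  rintro _ ⟨𝒰, h𝒰, rfl⟩
  refine ⟨_, ⟨𝒰, h𝒰, rfl⟩, transportSubgroup_mono ?_⟩
  rintro y σ v ⟨U, hU, hv⟩
  exact isThick_of_range_subset hU v hv


/-! ### Free null-homotopies -/

section FreeNull
open unitInterval

variable {Y : Type*} [TopologicalSpace Y] {n : ℕ}

/-- The map `f` on the cube is constant on `∂Iⁿ`, that is, an `n`-loop at an unspecified point. -/
def ConstOnBoundary (f : C(Fin n → I, Y)) : Prop :=
  ∃ y, ∀ s ∈ Cube.boundary (Fin n), f s = y

/-- For `u = 1` the identity of the interval; as `u` decreases to `0`, the interval is stretched about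
its midpoint until `[1/4, 3/4]` is mapped onto the whole interval and the rest to the end points. -/
noncomputable def stretch (u x : I) : I :=
  Set.projIcc 0 1 zero_le_one ((2 - u : ℝ) * x - (1 - u) / 2)

theorem continuous_stretch : Continuous fun p : I × I => stretch p.1 p.2 :=
  continuous_projIcc.comp (by fun_prop)

theorem stretch_one (x : I) : stretch 1 x = x := by
  have : ((2 - (1 : I) : ℝ) * x - (1 - (1 : I)) / 2) = x := by
    simp only [Set.Icc.coe_one]
    ring
  rw [stretch, this, Set.projIcc_val]

/-- A function on the cube that is `1` on `∂Iⁿ` and vanishes on the middle cube `[1/4, 3/4]ⁿ`, outside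
of which `stretch 0` maps to `∂Iⁿ`. -/
noncomputable def collar (s : Fin n → I) : I :=
  Finset.univ.sup fun i => Set.projIcc (0 : ℝ) 1 zero_le_one (|4 * (s i : ℝ) - 2| - 1)

theorem continuous_collar : Continuous (collar (n := n)) :=
  Continuous.finset_sup_apply fun i _ => continuous_projIcc.comp (by fun_prop)

theorem collar_eq_one {s : Fin n → I} (hs : s ∈ Cube.boundary (Fin n)) : collar s = 1 := by
  obtain ⟨i, hi⟩ := hs
  refine le_antisymm le_one' ?_
  refine le_trans (le_of_eq ?_) (Finset.le_sup (Finset.mem_univ i))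
  symm
  rw [projIcc_eq_one]
  rcases hi with hi | hi <;> rw [hi] <;> norm_num

theorem stretch_mem_boundary {u : I} {s : Fin n → I} (hs : s ∈ Cube.boundary (Fin n)) :
    (fun i => stretch u (s i)) ∈ Cube.boundary (Fin n) := by
  have h0 := u.2.2
  obtain ⟨i, hi | hi⟩ := hs
  · refine ⟨i, Or.inl ?_⟩
    change stretch u (s i) = 0
    rw [hi, stretch, projIcc_eq_zero]
    simp only [Set.Icc.coe_zero]
    linarith
  · refine ⟨i, Or.inr ?_⟩
    change stretch u (s i) = 1
    rw [hi, stretch, projIcc_eq_one]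
    simp only [Set.Icc.coe_one]
    linarith

theorem stretch_zero_mem_boundary {s : Fin n → I} (hs : collar s ≠ 0) :
    (fun i => stretch 0 (s i)) ∈ Cube.boundary (Fin n) := by
  have h : ∃ i, Set.projIcc (0 : ℝ) 1 zero_le_one (|4 * (s i : ℝ) - 2| - 1) ≠ 0 := by
    by_contra! h
    refine hs (le_antisymm (Finset.sup_le fun i _ => (h i).le) nonneg')
  obtain ⟨i, hi⟩ := h
  rw [Ne, projIcc_eq_zero, not_le, sub_pos, lt_abs] at hi
  rcases hi with hi | hi
  · refine ⟨i, Or.inr ?_⟩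
    change stretch 0 (s i) = 1
    rw [stretch, projIcc_eq_one]
    simp only [Set.Icc.coe_zero]
    linarith
  · refine ⟨i, Or.inl ?_⟩
    change stretch 0 (s i) = 0
    rw [stretch, projIcc_eq_zero]
    simp only [Set.Icc.coe_zero]
    linarith

/-- An `n`-loop that can be contracted to a constant through `n`-loops with moving base point is null
homotopic relative to the boundary. If `F` is the contraction and `γ` the path of the base point,
the loop is first deformed to `γ ∘ collar`, by running `F` backwards on a shrinking cube and
filling the collar around it with `γ`; then the collar is contracted along `γ`. -/
theorem homotopic_const_of_homotopicWith [NeZero n] {y₀ c : Y} (β : GenLoop (Fin n) Y y₀)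
    (h : ContinuousMap.HomotopicWith (ContinuousMap.const _ c) β.1 ConstOnBoundary) :
    GenLoop.Homotopic β GenLoop.const := by
  obtain ⟨F⟩ := h
  have h0 : (0 : Fin n → I) ∈ Cube.boundary (Fin n) := ⟨0, Or.inl rfl⟩
  let γ : I → Y := fun t => F (t, 0)
  have hγ : Continuous γ := F.continuous.comp (by fun_prop)
  have hF : ∀ t, ∀ s ∈ Cube.boundary (Fin n), F (t, s) = γ t := by
    intro t s hs
    obtain ⟨y, hy⟩ := F.prop' t
    exact (hy s hs).trans (hy 0 h0).symm
  have hF1 : ∀ s, F (1, s) = β s := F.apply_one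
  have hF0 : ∀ s, F (0, s) = c := F.apply_zero
  have hγ1 : γ 1 = y₀ := (hF1 0).trans (GenLoop.boundary β 0 h0)
  let m : GenLoop (Fin n) Y y₀ := ⟨⟨fun s => γ (collar s), hγ.comp continuous_collar⟩, fun s hs => by
    change γ (collar s) = y₀
    rw [collar_eq_one hs, hγ1]⟩
  have h1 : GenLoop.Homotopic m β := by
    refine ⟨⟨⟨⟨fun z => F (z.1 ⊔ collar z.2, fun i => stretch z.1 (z.2 i)), ?_⟩, ?_, ?_⟩, ?_⟩⟩
    · refine F.continuous.comp (Continuous.prodMk ?_ (continuous_pi fun i => ?_))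
      · exact continuous_fst.sup (continuous_collar.comp continuous_snd)
      · exact continuous_stretch.comp
          (continuous_fst.prodMk ((continuous_apply i).comp continuous_snd))
    · intro s
      change F (0 ⊔ collar s, fun i => stretch 0 (s i)) = γ (collar s)
      rw [sup_eq_right.2 nonneg']
      by_cases hs : collar s = 0
      · rw [hs, hF0]
        exact (hF0 0).symm
      · exact hF _ _ (stretch_zero_mem_boundary hs)
    · intro s
      change F (1 ⊔ collar s, fun i => stretch 1 (s i)) = β s
      simp only [stretch_one]
      rw [sup_eq_left.2 le_one', hF1]
    · intro t s hs
      change F (t ⊔ collar s, fun i => stretch t (s i)) = γ (collar s)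
      rw [hF _ _ (stretch_mem_boundary hs), collar_eq_one hs, sup_eq_right.2 le_one']
  have h2 : GenLoop.Homotopic m GenLoop.const := by
    refine ⟨⟨⟨⟨fun z => γ (z.1 ⊔ collar z.2), ?_⟩, ?_, ?_⟩, ?_⟩⟩
    · exact hγ.comp (continuous_fst.sup (continuous_collar.comp continuous_snd))
    · intro s
      change γ (0 ⊔ collar s) = γ (collar s)
      rw [sup_eq_right.2 nonneg']
    · intro s
      change γ (1 ⊔ collar s) = y₀
      rw [sup_eq_left.2 le_one', hγ1]
    · intro t s hs
      change γ (t ⊔ collar s) = γ (collar s)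
      rw [collar_eq_one hs, sup_eq_right.2 le_one']
  exact h1.symm.trans h2

/-- After composition with a map `p`, the homotopy that realizes `σ_#` is a homotopy through `n`-loops
with moving base point. -/
theorem IsTransport.homotopicWith {X : Type*} [TopologicalSpace X] {x₀ x₁ : X} {τ : Path x₀ x₁}
    {α : GenLoop (Fin n) X x₁} {β : GenLoop (Fin n) X x₀} (h : IsTransport τ α β) (p : C(X, Y)) :
    ContinuousMap.HomotopicWith (p.comp α.1) (p.comp β.1) ConstOnBoundary := by
  obtain ⟨F, h0, h1, hb⟩ := h
  refine ⟨⟨⟨⟨fun z => p (F (z.2, z.1)), by fun_prop⟩, fun s => congrArg p (h0 s),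
    fun s => congrArg p (h1 s)⟩, fun t => ⟨p (τ.symm t), fun s hs => congrArg p (hb s hs t)⟩⟩⟩

end FreeNull

/-! ### Open stars -/

section Star
open unitInterval

variable {V : Type*} {K : PreAbstractSimplicialComplex V}

/-- A map into the open star of a vertex contracts to that vertex along straight lines. The homotopy
depends on the point of the realization only, as the last clause says. -/
theorem Realization.exists_contraction_to_vertex {Y : Type*} [TopologicalSpace Y] {v : V}
    (hv : {v} ∈ K.faces) (f : C(Y, Realization K))
    (hlf : LocallyFinite fun w => {y | (f y).1 w ≠ 0})
    (hf : ∀ y, (f y).1 v ≠ 0) :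
    ∃ H : C(I × Y, Realization K), (∀ y, H (0, y) = Realization.vertex K v hv) ∧
      (∀ y, H (1, y) = f y) ∧ ∀ t y y', f y = f y' → H (t, y) = H (t, y') := by
  classical
  let c : I × Y → V →₀ ℝ := fun z =>
    (1 - (z.1 : ℝ)) • Finsupp.single v 1 + (z.1 : ℝ) • (f z.2).1
  have hc1 : ∀ z, ((c z).sum fun _ r => r) = 1 := by
    intro z
    simp only [c]
    rw [Finsupp.sum_add_index' (fun _ => rfl) (fun _ _ _ => rfl),
      Finsupp.sum_smul_index (fun _ => rfl), Finsupp.sum_smul_index (fun _ => rfl),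
      ← Finsupp.mul_sum, ← Finsupp.mul_sum, (f z.2).2.2.2, Finsupp.sum_single_index rfl]
    ring
  have hcs : ∀ z, (c z).support ∈ K.faces := by
    intro z
    refine Realization.support_mem (f z.2).2.2.1 ?_ (hc1 z)
    refine Finsupp.support_add.trans (Finset.union_subset ?_ Finsupp.support_smul)
    refine Finsupp.support_smul.trans (Finsupp.support_single_subset.trans ?_)
    exact Finset.singleton_subset_iff.2 (Finsupp.mem_support_iff.2 (hf z.2))
  have hc0 : ∀ z w, 0 ≤ c z w := by
    intro z w
    simp only [c, Finsupp.add_apply, Finsupp.smul_apply, smul_eq_mul, Finsupp.single_apply]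
    refine add_nonneg (mul_nonneg (sub_nonneg.2 z.1.2.2) ?_)
      (mul_nonneg z.1.2.1 ((f z.2).2.1 w))
    split_ifs <;> norm_num
  let H : I × Y → Realization K := fun z => ⟨c z, hc0 z, hcs z, hc1 z⟩
  have hHc : Continuous H := by
    refine Realization.continuous_of_coord H (fun w => ?_) ?_
    · change Continuous fun z : I × Y => c z w
      simp only [c, Finsupp.add_apply, Finsupp.smul_apply, smul_eq_mul]
      have h2 := (Realization.continuous_coord K w).comp (f.continuous.comp continuous_snd)
        (X := I × Y)
      exact ((continuous_const.sub (continuous_subtype_val.comp continuous_fst)).mul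
        continuous_const).add ((continuous_subtype_val.comp continuous_fst).mul h2)
    · -- no new vertex occurs, since every `f y` has positive `v`-coordinate
      refine (hlf.preimage_continuous continuous_snd).subset fun w z hz => ?_
      by_contra hne
      simp only [Set.mem_preimage, Set.mem_ofPred_eq, not_not] at hne
      have hvw : v ≠ w := fun h => hf z.2 (h ▸ hne)
      apply hz
      change c z w = 0
      simp [c, hne, hvw]
  refine ⟨⟨H, hHc⟩, fun y => Subtype.ext ?_, fun y => Subtype.ext ?_, fun t y y' h =>
    Subtype.ext ?_⟩
  · change c (0, y) = Finsupp.single v 1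
    simp [c]
  · change c (1, y) = (f y).1
    simp [c]
  · change c (t, y) = c (t, y')
    simp only [c, h]

end Star

/-! ### Kernels of the canonical homomorphisms -/

section Canonical

variable {X : Type*} [TopologicalSpace X] {x₀ : X}

/-- If a member `φ_U` of the partition of unity vanishes nowhere on the loop `v`, then `p_𝒰 ∘ v` lies
in the open star of the vertex `U`, so that `p_𝒰#` annihilates every `σ_#[v]`. -/
theorem PointedCover.canonicalHom_eq_one_of_partition_ne_zero (n : ℕ) [NeZero n]
    (𝒰 : PointedCover X x₀) (U : 𝒰.cover) {y : X} {σ : Path x₀ y} {v : GenLoop (Fin n) X y}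
    {β : GenLoop (Fin n) X x₀} (hU : ∀ s, 𝒰.partition U (v s) ≠ 0) (h : IsTransport σ v β) :
    canonicalHom n 𝒰 (Quotient.mk _ β) = 1 := by
  have hv : {U} ∈ (nerve 𝒰.cover).faces :=
    ⟨Finset.singleton_nonempty U, v 0, fun W hW =>
      Finset.mem_singleton.1 hW ▸ 𝒰.partition_mem (hU 0)⟩
  obtain ⟨H, H0, H1, Hc⟩ := Realization.exists_contraction_to_vertex hv (𝒰.canonicalMap.comp v.1)
    (𝒰.partition.locallyFinite.preimage_continuous v.1.continuous) hU
  have h1 : ContinuousMap.HomotopicWith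
      (ContinuousMap.const (Fin n → unitInterval) (Realization.vertex _ U hv))
      (𝒰.canonicalMap.comp v.1) ConstOnBoundary := by
    refine ⟨⟨⟨H, H0, H1⟩, fun t => ⟨H (t, 0), fun s hs => Hc t s 0 ?_⟩⟩⟩
    exact congrArg 𝒰.canonicalMap
      ((GenLoop.boundary v s hs).trans (GenLoop.boundary v 0 ⟨0, Or.inl rfl⟩).symm)
  rw [HomotopyGroup.one_def]
  obtain ⟨F⟩ := h1
  obtain ⟨G⟩ := IsTransport.homotopicWith h 𝒰.canonicalMap
  exact Quotient.sound
    (homotopic_const_of_homotopicWith (mapLoop _ 𝒰.canonicalMap_base β) ⟨F.trans G⟩)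

/-- The open sets `W` on which all functions of the partition of unity differ from their values at a
suitable point `x` by less than a quarter of the largest of the values at `x`. -/
def PointedCover.controlledCover (𝒰 : PointedCover X x₀) : Set (Set X) :=
  {W | IsOpen W ∧ ∃ (x : X) (U : 𝒰.cover), 0 < 𝒰.partition U x ∧
    (∀ U', 𝒰.partition U' x ≤ 𝒰.partition U x) ∧
    ∀ y ∈ W, ∀ U', |𝒰.partition U' y - 𝒰.partition U' x| < 𝒰.partition U x / 4}

/-- By local finiteness only finitely many functions of the partition of unity have to be controlled
near a given point. -/
theorem PointedCover.isOpenCover_controlledCover (𝒰 : PointedCover X x₀) :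
    IsOpenCover 𝒰.controlledCover where
  isOpen := fun _ h => h.1
  covers := by
    refine Set.eq_univ_of_forall fun x => ?_
    obtain ⟨U₁, hU₁⟩ := 𝒰.partition.exists_pos (Set.mem_univ x)
    have hmem : ∀ {U'}, U' ∈ 𝒰.partition.finsupport x ↔ 𝒰.partition U' x ≠ 0 := by
      intro U'
      rw [PartitionOfUnity.mem_finsupport, Function.mem_support]
    obtain ⟨U, hU, hmax⟩ := (𝒰.partition.finsupport x).exists_max_image
      (fun U' => 𝒰.partition U' x) ⟨U₁, hmem.2 hU₁.ne'⟩
    have hpos : 0 < 𝒰.partition U x := lt_of_le_of_ne (𝒰.partition.nonneg U x) (hmem.1 hU).symm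
    obtain ⟨N, hN, hfin⟩ := 𝒰.partition.locallyFinite x
    let W : Set X := N ∩ ⋂ U' ∈ hfin.toFinset,
      {y | |𝒰.partition U' y - 𝒰.partition U' x| < 𝒰.partition U x / 4}
    have hW : W ∈ 𝓝 x := by
      refine Filter.inter_mem hN ((Filter.biInter_finset_mem _).2 fun U' _ => ?_)
      refine IsOpen.mem_nhds ?_ ?_
      · exact isOpen_lt (((𝒰.partition U').continuous.sub continuous_const).abs) continuous_const
      · simpa using hpos
    refine ⟨interior W, ⟨isOpen_interior, x, U, hpos, fun U' => ?_, fun y hy U' => ?_⟩,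
      mem_interior_iff_mem_nhds.2 hW⟩
    · by_cases h : 𝒰.partition U' x = 0
      · rw [h]
        exact hpos.le
      · exact hmax U' (hmem.2 h)
    · have hyW := interior_subset hy
      by_cases h : U' ∈ hfin.toFinset
      · exact Set.mem_iInter₂.1 hyW.2 U' h
      · have h0 : ∀ z ∈ N, 𝒰.partition U' z = 0 := by
          intro z hz
          by_contra hne
          exact h (hfin.mem_toFinset.2 ⟨z, hne, hz⟩)
        rw [h0 y hyW.1, h0 x (mem_of_mem_nhds hN)]
        simpa using hpos

theorem PointedCover.exists_partition_pos_of_mem {𝒰 : PointedCover X x₀} {W : Set X}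
    (hW : W ∈ 𝒰.controlledCover) : ∃ U, ∀ y ∈ W, 0 < 𝒰.partition U y := by
  obtain ⟨-, x, U, hpos, -, h⟩ := hW
  refine ⟨U, fun y hy => ?_⟩
  have := abs_lt.1 (h y hy U)
  linarith

/-- If two members `W₁`, `W₂` of the controlled cover meet, then a function that attains the larger of
the two maximal values `m` exceeds `m - m/4` on the first of them, hence at a common point, hence
`m - 3m/4` on the other one. -/
theorem PointedCover.exists_partition_pos_of_inter {𝒰 : PointedCover X x₀} {W₁ W₂ : Set X}
    (hW₁ : W₁ ∈ 𝒰.controlledCover) (hW₂ : W₂ ∈ 𝒰.controlledCover) (h : (W₁ ∩ W₂).Nonempty) :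
    ∃ U, ∀ y ∈ W₁ ∪ W₂, 0 < 𝒰.partition U y := by
  obtain ⟨-, x₁, U₁, hpos₁, hmax₁, h₁⟩ := hW₁
  obtain ⟨-, x₂, U₂, hpos₂, hmax₂, h₂⟩ := hW₂
  obtain ⟨z, hz₁, hz₂⟩ := h
  -- three steps, each of less than a quarter of the larger maximum
  rcases le_total (𝒰.partition U₂ x₂) (𝒰.partition U₁ x₁) with hle | hle
  · refine ⟨U₁, ?_⟩
    have hz₁' := abs_lt.1 (h₁ z hz₁ U₁)
    have hz₂' := abs_lt.1 (h₂ z hz₂ U₁)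
    rintro y (hy | hy)
    · have := abs_lt.1 (h₁ y hy U₁)
      linarith
    · have := abs_lt.1 (h₂ y hy U₁)
      linarith
  · refine ⟨U₂, ?_⟩
    have hz₁' := abs_lt.1 (h₁ z hz₁ U₂)
    have hz₂' := abs_lt.1 (h₂ z hz₂ U₂)
    rintro y (hy | hy)
    · have := abs_lt.1 (h₁ y hy U₂)
      linarith
    · have := abs_lt.1 (h₂ y hy U₂)
      linarith

theorem PointedCover.weakThickSpanier_controlledCover_le_ker (n : ℕ) [NeZero n]
    (𝒰 : PointedCover X x₀) :
    weakThickSpanier n x₀ 𝒰.controlledCover ≤ (canonicalHom n 𝒰).ker := by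
  refine (Subgroup.closure_le _).2 ?_
  rintro _ ⟨y, σ, v, β, ⟨W₁, hW₁, W₂, hW₂, hv⟩, hT, rfl⟩
  obtain ⟨U, hU⟩ : ∃ U, ∀ s, 0 < 𝒰.partition U (v s) := by
    rcases (W₁ ∩ W₂).eq_empty_or_nonempty with h | h
    · -- the cube is connected, so the loop lies in one of two disjoint open sets
      have hconn : IsPreconnected (Set.range v) := isPreconnected_range v.1.continuous
      rcases hconn.subset_or_subset hW₁.1 hW₂.1 (Set.disjoint_iff_inter_eq_empty.2 h) hv with h | h
      · obtain ⟨U, hU⟩ := exists_partition_pos_of_mem hW₁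
        exact ⟨U, fun s => hU _ (h ⟨s, rfl⟩)⟩
      · obtain ⟨U, hU⟩ := exists_partition_pos_of_mem hW₂
        exact ⟨U, fun s => hU _ (h ⟨s, rfl⟩)⟩
    · obtain ⟨U, hU⟩ := exists_partition_pos_of_inter hW₁ hW₂ h
      exact ⟨U, fun s => hU _ (hv ⟨s, rfl⟩)⟩
  exact 𝒰.canonicalHom_eq_one_of_partition_ne_zero n U (fun s => (hU s).ne') hT

/-- The shape topology is the initial topology for the maps `p_𝒰#` to discrete groups, and the kernel
of `p_𝒰#` contains the weak thick Spanier subgroup of the controlled cover. -/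
theorem shapeTopology_isCoarser (x₀ : X) (n : ℕ) [NeZero n] :
    shapeTopology n x₀ ≼ₜ weakThickSpanierTopology n x₀ := by
  suffices weakThickSpanierTopology n x₀ ≤ shapeTopology n x₀ from this
  rw [shapeTopology, shapeGroupTopology, induced_compose]
  unfold Pi.topologicalSpace
  rw [induced_iInf]
  refine le_iInf fun 𝒰 => ?_
  rw [induced_compose]
  rintro _ ⟨T, -, rfl⟩
  refine (nbhdFamilyOfCovers (weakThickSpanier n x₀)
    (weakThickSpanier_mono n x₀)).isOpen_of_forall_smul_subset
    ⟨_, 𝒰.isOpenCover_controlledCover, rfl⟩ ?_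
  rintro a ha _ ⟨k, hk, rfl⟩
  have hk1 : canonicalHom n 𝒰 k = 1 := 𝒰.weakThickSpanier_controlledCover_le_ker n hk
  have hak : canonicalHom n 𝒰 (a * k) = canonicalHom n 𝒰 a := by rw [map_mul, hk1, mul_one]
  change canonicalHom n 𝒰 (a * k) ∈ T
  rw [hak]
  exact ha

end Canonical

end TopHomotopy

theorem mainTheorem3 {X : Type*} [TopologicalSpace X] (x₀ : X) (n : ℕ) [n.AtLeastTwo] :
    TopHomotopy.shapeTopology n x₀ ≼ₜ TopHomotopy.weakThickSpanierTopology n x₀ ∧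
      TopHomotopy.weakThickSpanierTopology n x₀ ≼ₜ TopHomotopy.thickSpanierTopology n x₀ ∧
      TopHomotopy.thickSpanierTopology n x₀ ≼ₜ TopHomotopy.spanierTopology n x₀ ∧
      TopHomotopy.spanierTopology n x₀ ≼ₜ TopHomotopy.pathSpanierTopology n x₀ :=
  ⟨TopHomotopy.shapeTopology_isCoarser x₀ n, TopHomotopy.weakThickSpanierTopology_isCoarser x₀ n,
    TopHomotopy.thickSpanierTopology_isCoarser x₀ n, TopHomotopy.spanierTopology_isCoarser x₀ n⟩
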